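/- Let $\mathbb F_\infty$ be the free group on generators $g_1,g_2,\dots$ and, for $i\ge 1$, let $U_i$ be the unitary operator on $\ell^2(\mathbb F_\infty)$ given by $(U_if)(x)=f(g_i^{-1}x)$. For an integer $N\ge 1$ let $\Phi_N$ be the quantum channel on the trace class operators of $\ell^2(\mathbb F_\infty)$ given by $$\Phi_N(\rho)=\frac1N\sum_{i=1}^N U_i\rho U_i^*.$$ Its tensor powers are the channels on the trace class operators of $\ell^2(\mathbb F_\infty)^{\otimes k}=\ell^2(\mathbb F_\infty^k)$ given by $$\Phi_N^{\otimes k}(\rho)=\frac1{N^k}\sum_{m\in\{1,\dots,N\}^k}U_m\rho U_m^*,\qquad U_m=U_{m_1}\otimes\cdots\otimes U_{m_k}.$$ For a state $\rho$ let $H(\rho)=-\sum_i\lambda_i\log\lambda_i$, where $\lambda_i$ are the eigenvalues of $\rho$ counted with multiplicity (and $0\log 0=0$). For a channel $\Phi$ let $H_{\min}(\Phi)=\inf_\xi H(\Phi(|\xi\rangle\langle\xi|))$, the infimum over all unit vectors $\xi$ of the input space, and let $\overline H_{\min}(\Phi)=\lim_{k\to\infty}\frac1kH_{\min}(\Phi^{\otimes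 k})$. Then, for every integer $N\ge1$: 1. for every integer $k\ge0$, $$H_{\min}(\Phi_N^{\otimes k})\ \ge\ k\log N-2\log\Bigl(1+\sqrt{(1+9/N)^k-1}\Bigr);$$ 2. the limit defining $\overline H_{\min}(\Phi_N)$ exists and is finite, and $$\overline H_{\min}(\Phi_N)\ \ge\ \log N-\log\Bigl(1+\frac9N\Bigr)\ \ge\ \log N-\frac9N .$$ -/

import Mathlib

open scoped ENNReal lp InnerProductSpace Topology

noncomputable section

namespace RegMOE

/-! ### Trace class operators -/

section TraceClass

variable {H : Type*} [NormedAddCommGroup H] [InnerProductSpace ℂ H]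

/-- `A` is a trace class operator: `A = ∑ₙ |xₙ⟩⟨yₙ|` with `∑ₙ ‖xₙ‖ ‖yₙ‖ < ∞`. -/
def IsTraceClass (A : H →L[ℂ] H) : Prop :=
  ∃ x y : ℕ → H, Summable (fun n => ‖x n‖ * ‖y n‖) ∧
    ∀ v : H, HasSum (fun n => ⟪y n, v⟫_ℂ • x n) (A v)

theorem IsTraceClass.zero : IsTraceClass (0 : H →L[ℂ] H) :=
  ⟨fun _ => 0, fun _ => 0, by simp, fun v => by simp⟩

theorem IsTraceClass.add {A B : H →L[ℂ] H} (hA : IsTraceClass A) (hB : IsTraceClass B) :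
    IsTraceClass (A + B) := by
  obtain ⟨x, y, hs, h⟩ := hA
  obtain ⟨x', y', hs', h'⟩ := hB
  refine ⟨fun n => Sum.elim x x' (Equiv.natSumNatEquivNat.symm n),
    fun n => Sum.elim y y' (Equiv.natSumNatEquivNat.symm n), ?_, fun v => ?_⟩
  · refine (Equiv.natSumNatEquivNat.symm.summable_iff
      (f := fun n => ‖Sum.elim x x' n‖ * ‖Sum.elim y y' n‖)).2 ?_
    exact Summable.sum _ hs hs'
  · refine (Equiv.natSumNatEquivNat.symm.hasSum_iff
      (f := fun n => ⟪Sum.elim y y' n, v⟫_ℂ • Sum.elim x x' n)).2 ?_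
    exact (h v).sum (h' v)

theorem IsTraceClass.smul {A : H →L[ℂ] H} (c : ℂ) (hA : IsTraceClass A) :
    IsTraceClass (c • A) := by
  obtain ⟨x, y, hs, h⟩ := hA
  refine ⟨fun n => c • x n, y, ?_, fun v => ?_⟩
  · simpa [norm_smul, mul_assoc] using hs.mul_left ‖c‖
  · simpa [smul_comm c] using (h v).const_smul c

/-- The space `𝒯(H)` of trace class operators on `H`. -/
def TraceClass (H : Type*) [NormedAddCommGroup H] [InnerProductSpace ℂ H] :
    Submodule ℂ (H →L[ℂ] H) where
  carrier := {A | IsTraceClass A}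
  zero_mem' := IsTraceClass.zero
  add_mem' := IsTraceClass.add
  smul_mem' c _ hA := IsTraceClass.smul c hA

theorem isTraceClass_rankOne (x y : H) : IsTraceClass (InnerProductSpace.rankOne ℂ x y) := by
  refine ⟨fun n => if n = 0 then x else 0, fun n => if n = 0 then y else 0, ?_, fun v => ?_⟩
  · refine summable_of_ne_finset_zero (s := {0}) fun n hn => ?_
    simp at hn
    simp [hn]
  · have h := hasSum_ite_eq (0 : ℕ) (⟪y, v⟫_ℂ • x)
    rw [InnerProductSpace.rankOne_apply]
    have e : (fun n : ℕ => ⟪if n = 0 then y else 0, v⟫_ℂ • if n = 0 then x else 0) =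
        fun n => if n = 0 then ⟪y, v⟫_ℂ • x else 0 := by
      funext n
      by_cases hn : n = 0 <;> simp [hn]
    rw [e]
    exact h

/-- The rank one operator `|ξ⟩⟨ξ|`; for a unit vector `ξ` it is a pure state. -/
def pureState (ξ : H) : TraceClass H :=
  ⟨InnerProductSpace.rankOne ℂ ξ ξ, isTraceClass_rankOne ξ ξ⟩

theorem IsTraceClass.conj [CompleteSpace H] {A : H →L[ℂ] H} (hA : IsTraceClass A)
    (E : H →L[ℂ] H) : IsTraceClass (E ∘L A ∘L ContinuousLinearMap.adjoint E) := by
  obtain ⟨x, y, hs, h⟩ := hA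
  refine ⟨fun n => E (x n), fun n => E (y n), ?_, fun v => ?_⟩
  · refine Summable.of_nonneg_of_le (fun n => by positivity) (fun n => ?_)
      (hs.mul_left (‖E‖ * ‖E‖))
    calc ‖E (x n)‖ * ‖E (y n)‖ ≤ (‖E‖ * ‖x n‖) * (‖E‖ * ‖y n‖) := by
          gcongr <;> exact E.le_opNorm _
      _ = _ := by ring
  · have := (h (ContinuousLinearMap.adjoint E v)).mapL E
    simpa [ContinuousLinearMap.adjoint_inner_right] using this

/-! ### Channels with finitely many Kraus operators -/

/-- The map `𝒯(H) → 𝒯(H)`, `ρ ↦ ∑ᵢ Eᵢ ρ Eᵢ*`, with Kraus operators `E`. -/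
def krausMap [CompleteSpace H] {ι : Type*} [Fintype ι] (E : ι → H →L[ℂ] H) :
    TraceClass H →ₗ[ℂ] TraceClass H where
  toFun ρ := ⟨∑ i, E i ∘L (ρ : H →L[ℂ] H) ∘L ContinuousLinearMap.adjoint (E i),
    Submodule.sum_mem _ fun i _ => IsTraceClass.conj ρ.2 (E i)⟩
  map_add' ρ σ := by
    ext1
    simp [Finset.sum_add_distrib]
  map_smul' c ρ := by
    ext1
    simp [Finset.smul_sum]

/-! ### Entropy -/

/-- The von Neumann entropy `-∑ λ log λ` of a state `ρ`, the sum running over the eigenvalues of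
`ρ` counted with multiplicity (the eigenvalue `0` contributes nothing). For a state, all terms
are nonnegative, and the value may be `∞`. -/
def entropy (ρ : TraceClass H) : ℝ≥0∞ :=
  ∑' t : ℝ, (Module.finrank ℂ
      (Module.End.eigenspace ((ρ : H →L[ℂ] H) : H →ₗ[ℂ] H) (t : ℂ)) : ℝ≥0∞) *
    ENNReal.ofReal (-(t * Real.log t))

/-- The minimum output entropy `H_min(Φ) = inf_ξ H(Φ(|ξ⟩⟨ξ|))`, over unit vectors `ξ`. -/
def minOutputEntropy (Φ : TraceClass H →ₗ[ℂ] TraceClass H) : ℝ≥0∞ :=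
  ⨅ ξ : {ξ : H // ‖ξ‖ = 1}, entropy (Φ (pureState (ξ : H)))

end TraceClass

/-! ### Tensor powers

For a set `X`, the Hilbert space tensor power `ℓ²(X)^{⊗k}` is `ℓ²(X^k)`, where
`(f₁ ⊗ ⋯ ⊗ f_k)(x) = f₁(x₁) ⋯ f_k(x_k)`. -/

section Tensor

theorem memℓp_two_iff {X : Type*} {f : X → ℂ} :
    Memℓp f 2 ↔ Summable (fun x => ‖f x‖ ^ 2) := by
  rw [memℓp_gen_iff (by norm_num)]
  norm_num

theorem hasSum_norm_sq {X : Type*} (f : ℓ²(X, ℂ)) :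
    HasSum (fun x => ‖f x‖ ^ 2) (‖f‖ ^ 2) := by
  have := lp.hasSum_norm (p := 2) (by norm_num) f
  norm_num at this
  exact this

variable {X : Type*} {k : ℕ}

theorem memℓp_slice (f : ℓ²(Fin k → X, ℂ)) (j : Fin k) (x : Fin k → X) :
    Memℓp (fun t : X => f (Function.update x j t)) 2 :=
  memℓp_two_iff.2 ((hasSum_norm_sq f).summable.comp_injective (Function.update_injective x j))

/-- The function `t ↦ f(x₁, …, x_{j-1}, t, x_{j+1}, …, x_k)`. -/
def slice (f : ℓ²(Fin k → X, ℂ)) (j : Fin k) (x : Fin k → X) : ℓ²(X, ℂ) :=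
  ⟨fun t => f (Function.update x j t), memℓp_slice f j x⟩

theorem slice_apply (f : ℓ²(Fin k → X, ℂ)) (j : Fin k) (x : Fin k → X) (t : X) :
    slice f j x t = f (Function.update x j t) := rfl

theorem hasSum_slice (j : Fin k) (A : ℓ²(X, ℂ) →L[ℂ] ℓ²(X, ℂ)) (f : ℓ²(Fin k → X, ℂ)) :
    Summable (fun x => ‖A (slice f j x) (x j)‖ ^ 2) ∧
      ∑' x, ‖A (slice f j x) (x j)‖ ^ 2 ≤ ‖A‖ ^ 2 * ‖f‖ ^ 2 := by
  classical
  let e : ({i // i ≠ j} → X) × X ≃ (Fin k → X) :=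
    (Equiv.prodComm _ _).trans (Equiv.funSplitAt j X).symm
  have hej : ∀ r t, e (r, t) j = t := fun r t => by simp [e, Equiv.funSplitAt]
  have heu : ∀ r t s, Function.update (e (r, t)) j s = e (r, s) := fun r t s => by
    ext i
    by_cases h : i = j
    · subst h; simp [e, Equiv.funSplitAt]
    · simp [e, Equiv.funSplitAt, h]
  by_cases hX : IsEmpty (Fin k → X)
  · simp only [tsum_empty]
    exact ⟨(hasSum_empty).summable, by positivity⟩
  obtain ⟨x₀⟩ := not_isEmpty_iff.1 hX
  let t₀ := x₀ j
  have hsl : ∀ r t, slice f j (e (r, t)) = slice f j (e (r, t₀)) := fun r t => by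
    ext s
    simp [slice_apply, heu]
  have hf : HasSum (fun p => ‖f (e p)‖ ^ 2) (‖f‖ ^ 2) := e.hasSum_iff.2 (hasSum_norm_sq f)
  have hfr : HasSum (fun r => ‖slice f j (e (r, t₀))‖ ^ 2) (‖f‖ ^ 2) :=
    hf.prod_fiberwise fun r => by
      simpa [slice_apply, heu] using hasSum_norm_sq (slice f j (e (r, t₀)))
  have hg : ∀ r, HasSum (fun t => ‖A (slice f j (e (r, t))) (e (r, t) j)‖ ^ 2)
      (‖A (slice f j (e (r, t₀)))‖ ^ 2) := fun r => by
    simp only [hej, hsl]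
    exact hasSum_norm_sq _
  have hle : ∀ r, ‖A (slice f j (e (r, t₀)))‖ ^ 2 ≤ ‖A‖ ^ 2 * ‖slice f j (e (r, t₀))‖ ^ 2 :=
    fun r => by
      rw [← mul_pow]
      gcongr
      exact A.le_opNorm _
  have hsr : Summable (fun r => ‖A (slice f j (e (r, t₀)))‖ ^ 2) :=
    Summable.of_nonneg_of_le (fun r => by positivity) hle (hfr.summable.mul_left _)
  have hsum : Summable (fun p => ‖A (slice f j (e p)) (e p j)‖ ^ 2) := by
    refine (summable_prod_of_nonneg fun p => by positivity).2 ⟨fun r => (hg r).summable, ?_⟩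
    simpa only [(hg _).tsum_eq] using hsr
  refine ⟨e.summable_iff.1 hsum, ?_⟩
  rw [← e.tsum_eq, hsum.tsum_prod' fun r => (hg r).summable]
  simp only [(hg _).tsum_eq]
  rw [← hfr.tsum_eq, ← tsum_mul_left]
  exact hsr.tsum_le_tsum hle (hfr.summable.mul_left _)

/-- The operator `1 ⊗ ⋯ ⊗ A ⊗ ⋯ ⊗ 1` on `ℓ²(X)^{⊗k} = ℓ²(X^k)` that acts by `A` on the `j`-th
tensor factor. -/
def actOnFactor (j : Fin k) (A : ℓ²(X, ℂ) →L[ℂ] ℓ²(X, ℂ)) :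
    ℓ²(Fin k → X, ℂ) →L[ℂ] ℓ²(Fin k → X, ℂ) :=
  LinearMap.mkContinuous
    { toFun := fun f => ⟨fun x => A (slice f j x) (x j), memℓp_two_iff.2 (hasSum_slice j A f).1⟩
      map_add' := fun f g => by
        ext x
        have : slice (f + g) j x = slice f j x + slice g j x := rfl
        change A (slice (f + g) j x) (x j) = A (slice f j x) (x j) + A (slice g j x) (x j)
        rw [this, map_add]
        rfl
      map_smul' := fun c f => by
        ext x
        have : slice (c • f) j x = c • slice f j x := rfl
        change A (slice (c • f) j x) (x j) = c • A (slice f j x) (x j)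
        rw [this, map_smul]
        rfl }
    ‖A‖ (fun f => by
      refine le_of_sq_le_sq ?_ (by positivity)
      rw [← (hasSum_norm_sq _).tsum_eq, mul_pow]
      exact (hasSum_slice j A f).2)

theorem actOnFactor_apply (j : Fin k) (A : ℓ²(X, ℂ) →L[ℂ] ℓ²(X, ℂ)) (f : ℓ²(Fin k → X, ℂ))
    (x : Fin k → X) : actOnFactor j A f x = A (slice f j x) (x j) := rfl

/-- The tensor product `A₁ ⊗ ⋯ ⊗ A_k` of bounded operators on `ℓ²(X)`, as an operator on
`ℓ²(X)^{⊗k} = ℓ²(X^k)`. -/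
def tensorOp (A : Fin k → ℓ²(X, ℂ) →L[ℂ] ℓ²(X, ℂ)) :
    ℓ²(Fin k → X, ℂ) →L[ℂ] ℓ²(Fin k → X, ℂ) :=
  (List.ofFn fun j => actOnFactor j (A j)).prod

theorem tensorOp_apply_of_eq_prod (A : Fin k → ℓ²(X, ℂ) →L[ℂ] ℓ²(X, ℂ)) (f : Fin k → ℓ²(X, ℂ))
    (F : ℓ²(Fin k → X, ℂ)) (hF : ∀ x, F x = ∏ j, f j (x j)) (x : Fin k → X) :
    tensorOp A F x = ∏ j, A j (f j) (x j) := by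
  have key : ∀ L : List (Fin k), L.Nodup → ∀ x,
      (L.map fun j => actOnFactor j (A j)).prod F x =
        ∏ j, (if j ∈ L then A j (f j) else f j) (x j) := by
    intro L
    induction L with
    | nil => intro _ x; simpa using hF x
    | cons i L ih =>
      intro hL x
      rw [List.nodup_cons] at hL
      set G := (L.map fun j => actOnFactor j (A j)).prod F with hG
      rw [List.map_cons, List.prod_cons, mul_apply_eq_comp, actOnFactor_apply, ← hG]
      have hs : slice G i x =
          (∏ j ∈ Finset.univ.erase i, (if j ∈ L then A j (f j) else f j) (x j)) • f i := by
        ext t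
        rw [slice_apply, ih hL.2, ← Finset.mul_prod_erase _ _ (Finset.mem_univ i)]
        rw [Function.update_self, if_neg hL.1, lp.coeFn_smul, Pi.smul_apply, smul_eq_mul, mul_comm]
        congr 1
        refine Finset.prod_congr rfl fun j hj => ?_
        rw [Function.update_of_ne (Finset.ne_of_mem_erase hj)]
      rw [hs, map_smul, lp.coeFn_smul, Pi.smul_apply, smul_eq_mul,
        ← Finset.mul_prod_erase _ _ (Finset.mem_univ i), mul_comm, if_pos List.mem_cons_self]
      congr 1
      refine Finset.prod_congr rfl fun j hj => ?_
      simp [Finset.ne_of_mem_erase hj]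
  rw [tensorOp, List.ofFn_eq_map, key _ (List.nodup_finRange k)]
  simp

/-- The `k`-th tensor power `Φ^{⊗k}` of the map `Φ` with Kraus operators `E`: it has the Kraus
operators `E_{m₁} ⊗ ⋯ ⊗ E_{m_k}`. -/
def tensorPower {ι : Type*} [Fintype ι] (E : ι → ℓ²(X, ℂ) →L[ℂ] ℓ²(X, ℂ)) (k : ℕ) :
    TraceClass ℓ²(Fin k → X, ℂ) →ₗ[ℂ] TraceClass ℓ²(Fin k → X, ℂ) :=
  krausMap fun m : Fin k → ι => tensorOp fun j => E (m j)

/-- The regularized minimum output entropy `lim_k H_min(Φ^{⊗k}) / k` of the map `Φ` with Kraus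
operators `E`. -/
def regularizedMOE {ι : Type*} [Fintype ι] (E : ι → ℓ²(X, ℂ) →L[ℂ] ℓ²(X, ℂ)) : ℝ≥0∞ :=
  Filter.limUnder Filter.atTop fun k : ℕ => minOutputEntropy (tensorPower E k) / (k : ℝ≥0∞)

end Tensor

/-! ### The channel on the free group -/

/-- The left translation `(U f)(x) = f(g⁻¹ x)` on `ℓ²(G)`. -/
def leftTranslation {G : Type*} [Group G] (g : G) : ℓ²(G, ℂ) →L[ℂ] ℓ²(G, ℂ) :=
  LinearMap.mkContinuous
    { toFun := fun f => ⟨fun x => f (g⁻¹ * x), memℓp_two_iff.2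
        ((Equiv.mulLeft g⁻¹).summable_iff.2 (hasSum_norm_sq f).summable)⟩
      map_add' := fun _ _ => rfl
      map_smul' := fun _ _ => rfl }
    1 (fun f => by
      refine le_of_sq_le_sq ?_ (by positivity)
      rw [← (hasSum_norm_sq _).tsum_eq, one_mul, ← (hasSum_norm_sq f).tsum_eq]
      exact ((Equiv.mulLeft g⁻¹).tsum_eq fun x => ‖f x‖ ^ 2).le)

/-- The Kraus operators `N^{-1/2} U_i`, `i = 1, …, N`, of the channel
`Φ_N(ρ) = (1/N) ∑ᵢ U_i ρ U_i*` on `ℓ²(𝔽_∞)`; here `U_i` is the left translation by the `i`-th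
generator of the free group `𝔽_∞` on countably many generators. -/
def freeKraus (N : ℕ) (i : Fin N) : ℓ²(FreeGroup ℕ, ℂ) →L[ℂ] ℓ²(FreeGroup ℕ, ℂ) :=
  ((Real.sqrt N : ℂ)⁻¹) • leftTranslation (FreeGroup.of (i : ℕ))

theorem krausMap_freeKraus_apply (N : ℕ) (ρ : TraceClass ℓ²(FreeGroup ℕ, ℂ)) :
    (krausMap (freeKraus N) ρ : ℓ²(FreeGroup ℕ, ℂ) →L[ℂ] ℓ²(FreeGroup ℕ, ℂ)) =
      (N : ℂ)⁻¹ • ∑ i : Fin N, leftTranslation (FreeGroup.of (i : ℕ)) ∘L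
        (ρ : ℓ²(FreeGroup ℕ, ℂ) →L[ℂ] ℓ²(FreeGroup ℕ, ℂ)) ∘L
          ContinuousLinearMap.adjoint (leftTranslation (FreeGroup.of (i : ℕ))) := by
  have h : ((Real.sqrt N : ℂ)⁻¹) * (Real.sqrt N : ℂ)⁻¹ = (N : ℂ)⁻¹ := by
    rw [← mul_inv, ← Complex.ofReal_mul, Real.mul_self_sqrt (Nat.cast_nonneg N)]
    simp
  simp only [krausMap, freeKraus, LinearMap.coe_mk, AddHom.coe_mk, Finset.smul_sum]
  refine Finset.sum_congr rfl fun i _ => ?_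
  ext1 v
  simp only [map_smulₛₗ, ContinuousLinearMap.comp_apply, smul_apply,
    smul_smul, map_inv₀, Complex.conj_ofReal, RingHom.id_apply]
  rw [h]

end RegMOE

end

/-!
The output of `Φ_N^{⊗k}` on a pure state `ξ` is `ρ = ∑ₘ |vₘ⟩⟨vₘ|` with
`vₘ = N^{-k/2} U_m ξ`. Its entropy is at least its Rényi entropy of order two, `-log Tr ρ²`
(`neg_log_sum_sq_le_sum_negMulLog`), and `Tr ρ²` is the sum of squares of the Gram matrix of the
`vₘ` (`exists_spectral_decomposition`), that is, `N^{-2k} ∑ₘₙ |⟨U_m ξ, U_n ξ⟩|²`. So it suffices to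
show that the last sum is at most `(N + 9)^k` (`sum_sq_norm_inner_generators_le`): this gives
`H(ρ) ≥ k (log N - log (1 + 9/N))`, which is stronger than the first bound, because
`x ≤ (1 + √(x - 1))²` for `x ≥ 1`.

The estimate is a form of Haagerup's inequality for products of free groups. Write
`⟨U_m ξ, U_n ξ⟩` as a sum over points `x` of `conj (ξ (g_m⁻¹ x)) ξ (g_n⁻¹ x)`. In each coordinate
with `i = mⱼ ≠ nⱼ = i'`, the word `xⱼ` begins with `g_{i'}`, or with `g_i`, or with neither. In
these three cases `g_i⁻¹ xⱼ` begins with `g_i⁻¹ g_{i'}`, or `g_{i'}⁻¹ xⱼ` begins with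
`g_{i'}⁻¹ g_i`, or the two words begin with `g_i⁻¹` and `g_{i'}⁻¹`; each time the pair of words
determines `(i, i')` (`card_leftSet_rightSet_le`). For a fixed choice of cases, the
Cauchy–Schwarz inequality bounds the squared sum over `x` by a product of two masses of `|ξ|²`, and
the sum over `(m, n)` of these products counts each pair of points at most `N^e` times, where `e`
is the number of coordinates with `mⱼ = nⱼ`
(`sum_sq_norm_inner_leftTranslation_le`). Combining the three cases costs another factor of three
per coordinate, so a coordinate contributes `N + 3 · 3 = N + 9`.

The limit exists by Fekete's lemma: the output on a product vector `ξ ⊗ η` is the tensor product of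
the outputs, and entropy is additive on such products (`entropy_prodVec`), so that
`k ↦ H_min(Φ_N^{⊗k})` is subadditive.
-/

namespace RegMOE

/-! ### Entropy of finite rank states -/

section Spectral

open InnerProductSpace (rankOne)

variable {H : Type*} [NormedAddCommGroup H] [InnerProductSpace ℂ H]

theorem sum_smul_rankOne_apply_inner {ι : Type*} [Fintype ι] {b : ι → H} (hb : Orthonormal ℂ b)
    (l : ι → ℝ) (v : H) (j : ι) :
    ⟪b j, (∑ i, (l i : ℂ) • rankOne ℂ (b i) (b i)) v⟫_ℂ = l j * ⟪b j, v⟫_ℂ := by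
  classical
  simp only [sum_apply, smul_apply,
    InnerProductSpace.rankOne_apply, inner_sum, inner_smul_right,
    orthonormal_iff_ite.1 hb]
  simp

theorem finrank_eigenspace_sum_smul_rankOne {ι : Type*} [Fintype ι] {b : ι → H}
    (hb : Orthonormal ℂ b) (l : ι → ℝ) {t : ℝ} (ht : t ≠ 0) :
    Module.finrank ℂ (Module.End.eigenspace
      ((∑ i, (l i : ℂ) • rankOne ℂ (b i) (b i) : H →L[ℂ] H) : H →ₗ[ℂ] H) (t : ℂ)) =
      Fintype.card {i // l i = t} := by
  classical
  have hspan : Module.End.eigenspace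
      ((∑ i, (l i : ℂ) • rankOne ℂ (b i) (b i) : H →L[ℂ] H) : H →ₗ[ℂ] H) (t : ℂ) =
      Submodule.span ℂ (Set.range fun i : {i // l i = t} => b i) := by
    have ht' : (t : ℂ) ≠ 0 := by exact_mod_cast ht
    apply le_antisymm
    · intro v hv
      rw [Module.End.mem_eigenspace_iff] at hv
      have hv' : (∑ i, (l i : ℂ) • rankOne ℂ (b i) (b i)) v = (t : ℂ) • v := hv
      have hc : ∀ j, l j ≠ t → ⟪b j, v⟫_ℂ = 0 := by
        intro j hj
        have h := sum_smul_rankOne_apply_inner hb l v j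
        rw [hv', inner_smul_right] at h
        have h2 : ((t : ℂ) - l j) * ⟪b j, v⟫_ℂ = 0 := by rw [sub_mul, h, sub_self]
        rcases mul_eq_zero.1 h2 with h3 | h3
        · exact absurd (by exact_mod_cast (sub_eq_zero.1 h3).symm) hj
        · exact h3
      have hv2 : v = (t : ℂ)⁻¹ • ∑ i, (l i : ℂ) • ⟪b i, v⟫_ℂ • b i := by
        rw [eq_inv_smul_iff₀ ht', ← hv']
        simp
      rw [hv2]
      refine Submodule.smul_mem _ _ (Submodule.sum_mem _ fun i _ => Submodule.smul_mem _ _ ?_)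
      by_cases hi : l i = t
      · exact Submodule.smul_mem _ _ (Submodule.subset_span ⟨⟨i, hi⟩, rfl⟩)
      · simp [hc i hi]
    · rw [Submodule.span_le]
      rintro _ ⟨⟨j, rfl⟩, rfl⟩
      rw [SetLike.mem_coe, Module.End.mem_eigenspace_iff]
      simp [orthonormal_iff_ite.1 hb]
  rw [hspan]
  exact finrank_span_eq_card (hb.linearIndependent.comp _ Subtype.val_injective)

/-- The entropy of an operator that is diagonal in a finite orthonormal family. -/
theorem entropy_eq_sum {ι : Type*} [Fintype ι] {b : ι → H} (hb : Orthonormal ℂ b) (l : ι → ℝ)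
    {ρ : TraceClass H} (hρ : (ρ : H →L[ℂ] H) = ∑ i, (l i : ℂ) • rankOne ℂ (b i) (b i)) :
    entropy ρ = ∑ i, ENNReal.ofReal (Real.negMulLog (l i)) := by
  classical
  have h1 : ∀ t : ℝ, (Module.finrank ℂ
      (Module.End.eigenspace ((ρ : H →L[ℂ] H) : H →ₗ[ℂ] H) (t : ℂ)) : ℝ≥0∞) *
      ENNReal.ofReal (-(t * Real.log t)) =
      ∑ i, if t = l i then ENNReal.ofReal (Real.negMulLog (l i)) else 0 := by
    intro t
    by_cases ht : t = 0
    -- the kernel may be infinite-dimensional, but `0 log 0 = 0`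
    · subst ht
      have : ∀ i, (if 0 = l i then ENNReal.ofReal (Real.negMulLog (l i)) else 0) = 0 := by
        intro i
        split_ifs with h
        · simp [← h]
        · rfl
      simp [this]
    · rw [hρ, finrank_eigenspace_sum_smul_rankOne hb l ht, Fintype.card_subtype,
        ← nsmul_eq_mul, ← Finset.sum_const, Finset.sum_filter]
      refine Finset.sum_congr rfl fun i _ => ?_
      by_cases hi : l i = t
      · simp [hi, Real.negMulLog]
      · simp [hi, Ne.symm hi]
  rw [entropy, tsum_congr h1, Summable.tsum_finsetSum fun _ _ => ENNReal.summable]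
  exact Finset.sum_congr rfl fun i _ => tsum_ite_eq (l i) _

variable [CompleteSpace H]

theorem comp_rankOne_comp_adjoint {K : Type*} [NormedAddCommGroup K] [InnerProductSpace ℂ K]
    [CompleteSpace K] (L : K →L[ℂ] H) (a : K) :
    L ∘L rankOne ℂ a a ∘L ContinuousLinearMap.adjoint L = rankOne ℂ (L a) (L a) := by
  ext v
  simp [ContinuousLinearMap.adjoint_inner_right]

/-- The spectral theorem for `∑ₘ |vₘ⟩⟨vₘ|`, with the trace of this operator and of its square
expressed by the Gram matrix of `v`. -/
theorem exists_spectral_decomposition {κ : Type*} [Fintype κ] (v : κ → H) :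
    ∃ (n : ℕ) (b : Fin n → H) (l : Fin n → ℝ), Orthonormal ℂ b ∧ (∀ i, 0 ≤ l i) ∧
      ∑ m, rankOne ℂ (v m) (v m) = ∑ i, (l i : ℂ) • rankOne ℂ (b i) (b i) ∧
      ∑ i, l i = ∑ m, ‖v m‖ ^ 2 ∧ ∑ i, l i ^ 2 = ∑ m, ∑ n, ‖⟪v m, v n⟫_ℂ‖ ^ 2 := by
  classical
  -- the spectral theorem is applied on the finite-dimensional span of the `v m`
  let V : Submodule ℂ H := Submodule.span ℂ (Set.range v)
  have : FiniteDimensional ℂ V := FiniteDimensional.span_of_finite ℂ (Set.finite_range v)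
  have : CompleteSpace V := FiniteDimensional.complete ℂ V
  let w : κ → V := fun m => ⟨v m, Submodule.subset_span ⟨m, rfl⟩⟩
  let T : V →L[ℂ] V := ∑ m, rankOne ℂ (w m) (w m)
  have hT : (T : V →ₗ[ℂ] V).IsSymmetric := by
    intro x y
    simp [T, sum_inner, inner_sum, inner_smul_left, inner_smul_right, mul_comm]
  let n := Module.finrank ℂ V
  let b : OrthonormalBasis (Fin n) ℂ V := hT.eigenvectorBasis rfl
  let l : Fin n → ℝ := hT.eigenvalues rfl
  have hTb : ∀ i, T (b i) = (l i : ℂ) • b i := fun i => hT.apply_eigenvectorBasis rfl i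
  have hl : ∀ i, l i = ∑ m, ‖⟪b i, w m⟫_ℂ‖ ^ 2 := by
    intro i
    have h : (l i : ℂ) = ⟪b i, T (b i)⟫_ℂ := by
      rw [hTb, inner_smul_right, inner_self_eq_norm_sq_to_K, b.orthonormal.1 i]
      simp
    have h2 : ⟪b i, T (b i)⟫_ℂ = ∑ m, ((‖⟪b i, w m⟫_ℂ‖ ^ 2 : ℝ) : ℂ) := by
      simp only [T, sum_apply, InnerProductSpace.rankOne_apply, inner_sum,
        inner_smul_right]
      refine Finset.sum_congr rfl fun m _ => ?_
      rw [← inner_conj_symm (w m) (b i), mul_comm, Complex.mul_conj, Complex.normSq_eq_norm_sq]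
    rw [h2] at h
    exact_mod_cast h
  have hTl : T = ∑ i, (l i : ℂ) • rankOne ℂ (b i) (b i) := by
    ext1 x
    refine b.toBasis.ext_elem_iff.2 fun j => ?_
    simp only [OrthonormalBasis.coe_toBasis_repr_apply, OrthonormalBasis.repr_apply_apply]
    rw [sum_smul_rankOne_apply_inner b.orthonormal]
    have := hT (b j) x
    simp only [ContinuousLinearMap.coe_coe] at this
    rw [← this, hTb, inner_smul_left, Complex.conj_ofReal]
  refine ⟨n, fun i => (b i : H), l, ?_, ?_, ?_, ?_, ?_⟩
  · exact b.orthonormal.comp_linearIsometry V.subtypeₗᵢ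
  · intro i
    rw [hl]
    positivity
  · have h := congrArg (fun S => V.subtypeL ∘L S ∘L ContinuousLinearMap.adjoint V.subtypeL) hTl
    simp only [T, ContinuousLinearMap.finsetSum_comp, ContinuousLinearMap.comp_finsetSum,
      ContinuousLinearMap.smul_comp, ContinuousLinearMap.comp_smul,
      comp_rankOne_comp_adjoint] at h
    exact h
  · simp only [hl]
    rw [Finset.sum_comm]
    refine Finset.sum_congr rfl fun m _ => ?_
    rw [b.sum_sq_norm_inner_right]
    rfl
  · have h : ∀ m, ∑ n, ‖⟪w m, w n⟫_ℂ‖ ^ 2 = ∑ i, l i * ‖⟪b i, w m⟫_ℂ‖ ^ 2 := by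
      intro m
      have h1 : ⟪w m, T (w m)⟫_ℂ = ∑ n, ((‖⟪w m, w n⟫_ℂ‖ ^ 2 : ℝ) : ℂ) := by
        simp only [T, sum_apply, InnerProductSpace.rankOne_apply, inner_sum,
          inner_smul_right]
        refine Finset.sum_congr rfl fun n _ => ?_
        rw [← inner_conj_symm (w n) (w m), mul_comm, Complex.mul_conj, Complex.normSq_eq_norm_sq]
      have h2 : ⟪w m, T (w m)⟫_ℂ = ∑ i, ((l i * ‖⟪b i, w m⟫_ℂ‖ ^ 2 : ℝ) : ℂ) := by
        rw [hTl]
        simp only [sum_apply, smul_apply,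
          InnerProductSpace.rankOne_apply, inner_sum, inner_smul_right]
        refine Finset.sum_congr rfl fun n _ => ?_
        rw [← inner_conj_symm (w m) (b n), Complex.mul_conj, Complex.normSq_eq_norm_sq]
        push_cast
        rfl
      rw [h1] at h2
      exact_mod_cast h2
    calc ∑ i, l i ^ 2 = ∑ i, ∑ m, l i * ‖⟪b i, w m⟫_ℂ‖ ^ 2 := by
          refine Finset.sum_congr rfl fun i _ => ?_
          rw [← Finset.mul_sum, ← hl, sq]
      _ = ∑ m, ∑ n, ‖⟪w m, w n⟫_ℂ‖ ^ 2 := by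
          rw [Finset.sum_comm]
          exact Finset.sum_congr rfl fun m _ => (h m).symm
      _ = _ := rfl

end Spectral

/-- The Shannon entropy dominates the Rényi entropy of order two. -/
theorem neg_log_sum_sq_le_sum_negMulLog {ι : Type*} [Fintype ι] {l : ι → ℝ} (h0 : ∀ i, 0 ≤ l i)
    (h1 : ∑ i, l i = 1) : -Real.log (∑ i, l i ^ 2) ≤ ∑ i, Real.negMulLog (l i) := by
  set S := ∑ i, l i ^ 2 with hS
  have hpos : 0 < S := by
    obtain ⟨i, hi⟩ : ∃ i, l i ≠ 0 := by
      by_contra! h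
      simp [h] at h1
    exact Finset.sum_pos' (fun i _ => sq_nonneg _) ⟨i, Finset.mem_univ i, by positivity⟩
  -- `log y ≤ y - 1` at `y = l i / S`
  have hi : ∀ i, l i * (-Real.log S) + l i - l i ^ 2 / S ≤ Real.negMulLog (l i) := by
    intro i
    rcases (h0 i).eq_or_lt with h | h
    · simp [← h]
    · have := Real.log_le_sub_one_of_pos (div_pos h hpos)
      rw [Real.log_div h.ne' hpos.ne'] at this
      have h2 := mul_le_mul_of_nonneg_left this h.le
      have h3 : l i * (l i / S - 1) = l i ^ 2 / S - l i := by ring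
      rw [Real.negMulLog]
      linarith
  have := Finset.sum_le_sum fun i (_ : i ∈ Finset.univ) => hi i
  rw [Finset.sum_sub_distrib, Finset.sum_add_distrib, ← Finset.sum_mul, ← Finset.sum_div, h1,
    ← hS, div_self hpos.ne'] at this
  linarith

/-! ### Matrix coefficients of translations -/

section Coefficients

variable {G : Type*}

/-- The mass `∑_{a ∈ T} |ξ(a)|²` of `ξ` on the set `T`. -/
noncomputable def mass (ξ : ℓ²(G, ℂ)) (T : Set G) : ℝ := ∑' a, T.indicator (fun a => ‖ξ a‖ ^ 2) a

theorem mass_nonneg (ξ : ℓ²(G, ℂ)) (T : Set G) : 0 ≤ mass ξ T :=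
  tsum_nonneg fun _ => Set.indicator_nonneg (fun _ _ => by positivity) _

theorem summable_mass (ξ : ℓ²(G, ℂ)) (T : Set G) :
    Summable (T.indicator (fun a => ‖ξ a‖ ^ 2)) :=
  (hasSum_norm_sq ξ).summable.indicator T

/-- If a pair of points lies in at most `n` of the rectangles `A p × B p`, then the total mass of
these rectangles is at most `n ‖ξ‖⁴`. -/
theorem sum_mass_mul_mass_le {P : Type*} [Fintype P] (ξ : ℓ²(G, ℂ)) (A B : P → Set G) (n : ℕ)
    (h : ∀ a b, Nat.card {p // a ∈ A p ∧ b ∈ B p} ≤ n) :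
    ∑ p, mass ξ (A p) * mass ξ (B p) ≤ n * ‖ξ‖ ^ 4 := by
  classical
  have hs := (hasSum_norm_sq ξ).summable
  have hss : Summable fun q : G × G => ‖ξ q.1‖ ^ 2 * ‖ξ q.2‖ ^ 2 :=
    hs.mul_of_nonneg hs (fun _ => by positivity) fun _ => by positivity
  have hsp : ∀ p, Summable fun q : G × G => (A p).indicator (fun a => ‖ξ a‖ ^ 2) q.1 *
      (B p).indicator (fun a => ‖ξ a‖ ^ 2) q.2 := fun p =>
    (summable_mass ξ (A p)).mul_of_nonneg (summable_mass ξ (B p))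
      (fun _ => Set.indicator_nonneg (fun _ _ => by positivity) _)
      fun _ => Set.indicator_nonneg (fun _ _ => by positivity) _
  have h1 : ∀ p, mass ξ (A p) * mass ξ (B p) = ∑' q : G × G,
      (A p).indicator (fun a => ‖ξ a‖ ^ 2) q.1 * (B p).indicator (fun a => ‖ξ a‖ ^ 2) q.2 :=
    fun p => (summable_mass ξ (A p)).tsum_mul_tsum (summable_mass ξ (B p)) (hsp p)
  have h2 : ‖ξ‖ ^ 4 = ∑' q : G × G, ‖ξ q.1‖ ^ 2 * ‖ξ q.2‖ ^ 2 := by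
    rw [← hs.tsum_mul_tsum hs hss, (hasSum_norm_sq ξ).tsum_eq]
    ring
  simp only [h1]
  rw [← Summable.tsum_finsetSum fun p _ => hsp p, h2, ← tsum_mul_left]
  refine (summable_sum fun p _ => hsp p).tsum_le_tsum (fun q => ?_) (hss.mul_left _)
  calc ∑ p, (A p).indicator (fun a => ‖ξ a‖ ^ 2) q.1 * (B p).indicator (fun a => ‖ξ a‖ ^ 2) q.2
      = ∑ p, if q.1 ∈ A p ∧ q.2 ∈ B p then ‖ξ q.1‖ ^ 2 * ‖ξ q.2‖ ^ 2 else 0 := by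
        refine Finset.sum_congr rfl fun p _ => ?_
        by_cases ha : q.1 ∈ A p <;> by_cases hb : q.2 ∈ B p <;> simp [ha, hb]
    _ = (Nat.card {p // q.1 ∈ A p ∧ q.2 ∈ B p} : ℝ) * (‖ξ q.1‖ ^ 2 * ‖ξ q.2‖ ^ 2) := by
        rw [← Finset.sum_filter, Finset.sum_const, nsmul_eq_mul, Nat.card_eq_fintype_card,
          Fintype.card_subtype]
    _ ≤ _ := by
        gcongr
        exact h _ _

/-- The Cauchy–Schwarz inequality for a sum over a set `D` of points. -/
theorem tsum_indicator_mul_le (ξ : ℓ²(G, ℂ)) [Group G] (g h : G) (D A B : Set G)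
    (hA : ∀ x ∈ D, g⁻¹ * x ∈ A) (hB : ∀ x ∈ D, h⁻¹ * x ∈ B) :
    ∑' x, D.indicator (fun x => ‖ξ (g⁻¹ * x)‖ * ‖ξ (h⁻¹ * x)‖) x ≤
      √(mass ξ A * mass ξ B) := by
  have key : ∀ (g : G) (A : Set G), (∀ x ∈ D, g⁻¹ * x ∈ A) →
      Summable (fun x => D.indicator (fun x => ‖ξ (g⁻¹ * x)‖) x ^ (2 : ℝ)) ∧
      ∑' x, D.indicator (fun x => ‖ξ (g⁻¹ * x)‖) x ^ (2 : ℝ) ≤ mass ξ A := by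
    intro g A hA
    have hs := (Equiv.mulLeft g⁻¹).summable_iff.2 (summable_mass ξ A)
    have hle : ∀ x, D.indicator (fun x => ‖ξ (g⁻¹ * x)‖) x ^ (2 : ℝ) ≤
        (A.indicator (fun a => ‖ξ a‖ ^ 2) ∘ Equiv.mulLeft g⁻¹) x := by
      intro x
      rw [Real.rpow_two]
      by_cases hx : x ∈ D
      · simp [hx, hA x hx]
      · simp only [Set.indicator_of_notMem hx, Function.comp_apply]
        rw [zero_pow two_ne_zero]
        exact Set.indicator_nonneg (fun _ _ => by positivity) _
    have hs' := Summable.of_nonneg_of_le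
      (fun x => Real.rpow_nonneg (Set.indicator_nonneg (fun _ _ => by positivity) _) _) hle hs
    refine ⟨hs', (hs'.tsum_le_tsum hle hs).trans_eq ?_⟩
    exact (Equiv.mulLeft g⁻¹).tsum_eq _
  obtain ⟨hsA, hA'⟩ := key g A hA
  obtain ⟨hsB, hB'⟩ := key h B hB
  have hnn : ∀ g : G, 0 ≤ ∑' x, D.indicator (fun x => ‖ξ (g⁻¹ * x)‖) x ^ (2 : ℝ) := fun g =>
    tsum_nonneg fun _ => Real.rpow_nonneg (Set.indicator_nonneg (fun _ _ => by positivity) _) _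
  have := (Real.inner_le_Lp_mul_Lq_tsum_of_nonneg (p := 2) (q := 2)
    (Real.holderConjugate_iff.2 (by norm_num))
    (fun x => Set.indicator_nonneg (fun _ _ => by positivity) _)
    (fun x => Set.indicator_nonneg (fun _ _ => by positivity) _) hsA hsB)
  rw [← Real.sqrt_eq_rpow, ← Real.sqrt_eq_rpow, ← Real.sqrt_mul
    (hnn _)] at this
  simp only [← Set.indicator_mul] at this
  refine this.trans (Real.sqrt_le_sqrt ?_)
  exact mul_le_mul hA' hB' (hnn _) (mass_nonneg _ _)

/-- Suppose that, for each index `p`, the points `x` of the group are sorted into types `τ p x`,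
such that `x ↦ (g p)⁻¹ x` and `x ↦ (h p)⁻¹ x` map the points of type `s` into `A s p` and `B s p`.
If each pair of points lies in at most `n s` of the rectangles `A s p × B s p`, then the matrix
coefficients of the `(g p)⁻¹ (h p)` are square summable with a bound that does not depend on the
number of indices. The sum over the types is estimated by the Cauchy–Schwarz inequality with the
weights `c`. -/
theorem sum_sq_norm_inner_leftTranslation_le [Group G] {P S : Type*} [Fintype P] [Fintype S]
    (g h : P → G) (ξ : ℓ²(G, ℂ)) (allowed : P → Finset S) (c : S → ℝ) (hc : ∀ s, 0 < c s)
    (hsum : ∀ p, ∑ s ∈ allowed p, (c s)⁻¹ ≤ 1) (τ : P → G → S) (hτ : ∀ p x, τ p x ∈ allowed p)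
    (A B : S → P → Set G) (hA : ∀ p x, (g p)⁻¹ * x ∈ A (τ p x) p)
    (hB : ∀ p x, (h p)⁻¹ * x ∈ B (τ p x) p) (n : S → ℕ)
    (hn : ∀ s a b, Nat.card {p // a ∈ A s p ∧ b ∈ B s p} ≤ n s) :
    ∑ p, ‖⟪leftTranslation (g p) ξ, leftTranslation (h p) ξ⟫_ℂ‖ ^ 2 ≤
      (∑ s, c s * n s) * ‖ξ‖ ^ 4 := by
  classical
  have hp : ∀ p, ‖⟪leftTranslation (g p) ξ, leftTranslation (h p) ξ⟫_ℂ‖ ^ 2 ≤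
      ∑ s, c s * (mass ξ (A s p) * mass ξ (B s p)) := by
    intro p
    set D : S → Set G := fun s => {x | τ p x = s} with hD
    have hsq : Summable fun x => ‖ξ ((g p)⁻¹ * x)‖ * ‖ξ ((h p)⁻¹ * x)‖ := by
      have h1 := (Equiv.mulLeft (g p)⁻¹).summable_iff.2 (hasSum_norm_sq ξ).summable
      have h2 := (Equiv.mulLeft (h p)⁻¹).summable_iff.2 (hasSum_norm_sq ξ).summable
      refine Summable.of_nonneg_of_le (fun x => by positivity) (fun x => ?_) (h1.add h2)
      simp only [Function.comp_apply, Equiv.coe_mulLeft]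
      nlinarith [sq_nonneg (‖ξ ((g p)⁻¹ * x)‖ - ‖ξ ((h p)⁻¹ * x)‖),
        sq_nonneg (‖ξ ((g p)⁻¹ * x)‖), sq_nonneg (‖ξ ((h p)⁻¹ * x)‖)]
    have h1 : ‖⟪leftTranslation (g p) ξ, leftTranslation (h p) ξ⟫_ℂ‖ ≤
        ∑' x, ‖ξ ((g p)⁻¹ * x)‖ * ‖ξ ((h p)⁻¹ * x)‖ := by
      rw [lp.inner_eq_tsum]
      have hn : ∀ x, ‖⟪(leftTranslation (g p) ξ : ℓ²(G, ℂ)) x,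
          (leftTranslation (h p) ξ : ℓ²(G, ℂ)) x⟫_ℂ‖ =
          ‖ξ ((g p)⁻¹ * x)‖ * ‖ξ ((h p)⁻¹ * x)‖ := by
        intro x
        change ‖⟪ξ ((g p)⁻¹ * x), ξ ((h p)⁻¹ * x)⟫_ℂ‖ = _
        simp [mul_comm]
      rw [← tsum_congr hn]
      exact norm_tsum_le_tsum_norm (hsq.congr fun x => (hn x).symm)
    have h2 : ∑' x, ‖ξ ((g p)⁻¹ * x)‖ * ‖ξ ((h p)⁻¹ * x)‖ = ∑ s ∈ allowed p,
        ∑' x, (D s).indicator (fun x => ‖ξ ((g p)⁻¹ * x)‖ * ‖ξ ((h p)⁻¹ * x)‖) x := by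
      rw [← Summable.tsum_finsetSum fun s _ => hsq.indicator (D s)]
      refine tsum_congr fun x => ?_
      rw [Finset.sum_eq_single_of_mem _ (hτ p x)]
      · simp [hD]
      · intro s _ hs
        exact Set.indicator_of_notMem (fun h => hs h.symm) _
    have h3 : ‖⟪leftTranslation (g p) ξ, leftTranslation (h p) ξ⟫_ℂ‖ ≤
        ∑ s ∈ allowed p, √(mass ξ (A s p) * mass ξ (B s p)) := by
      refine (h1.trans_eq h2).trans (Finset.sum_le_sum fun s _ => ?_)
      refine tsum_indicator_mul_le ξ _ _ _ _ _ ?_ ?_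
      · rintro x rfl
        exact hA p x
      · rintro x rfl
        exact hB p x
    have hnn : ∀ s, 0 ≤ mass ξ (A s p) * mass ξ (B s p) := fun s =>
      mul_nonneg (mass_nonneg _ _) (mass_nonneg _ _)
    have hcnn : ∀ s, 0 ≤ c s * (mass ξ (A s p) * mass ξ (B s p)) := fun s =>
      mul_nonneg (hc s).le (hnn s)
    calc _ ≤ (∑ s ∈ allowed p, √(mass ξ (A s p) * mass ξ (B s p))) ^ 2 := by gcongr
      _ ≤ (∑ s ∈ allowed p, c s * (mass ξ (A s p) * mass ξ (B s p))) *
          ∑ s ∈ allowed p, (c s)⁻¹ := by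
        refine Finset.sum_sq_le_sum_mul_sum_of_sq_le_mul _ (fun s _ => hcnn s)
          (fun s _ => (inv_pos.2 (hc s)).le) fun s _ => ?_
        rw [Real.sq_sqrt (hnn s), mul_comm (c s), mul_assoc, mul_inv_cancel₀ (hc s).ne', mul_one]
      _ ≤ (∑ s ∈ allowed p, c s * (mass ξ (A s p) * mass ξ (B s p))) * 1 := by
        gcongr
        · exact Finset.sum_nonneg fun s _ => hcnn s
        · exact hsum p
      _ ≤ _ := by
        rw [mul_one]
        exact Finset.sum_le_sum_of_subset_of_nonneg (Finset.subset_univ _) fun s _ _ => hcnn s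
  refine (Finset.sum_le_sum fun p _ => hp p).trans ?_
  rw [Finset.sum_comm, Finset.sum_mul]
  refine Finset.sum_le_sum fun s _ => ?_
  rw [← Finset.mul_sum, mul_assoc]
  exact mul_le_mul_of_nonneg_left (sum_mass_mul_mass_le ξ _ _ _ (hn s)) (hc s).le

end Coefficients

/-! ### Cancellation in the free group -/

section FreeGroup

open FreeGroup (of)

theorem toWord_of_inv_mul {α : Type*} [DecidableEq α] {i : α} {x : FreeGroup α}
    (hx : x.toWord.head? ≠ some (i, true)) :
    ((of i)⁻¹ * x).toWord = (i, false) :: x.toWord := by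
  have h : (of i)⁻¹.toWord = [(i, false)] := by simp [FreeGroup.toWord_inv, FreeGroup.invRev]
  rw [FreeGroup.toWord_mul, h, List.singleton_append, FreeGroup.reduce.cons,
    FreeGroup.reduce_toWord]
  cases hw : x.toWord with
  | nil => rfl
  | cons y L =>
    have : ¬(i = y.1 ∧ false = !y.2) := by
      rintro ⟨rfl, h2⟩
      refine hx ?_
      rw [hw]
      rcases y with ⟨a, _ | _⟩
      · simp at h2
      · rfl
    exact if_neg this

variable {N : ℕ}

/-- The type of `x` with respect to the pair of generators `gᵢ, gⱼ`: it is `none` if `i = j`, and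
otherwise records whether the word `x` begins with `gⱼ` (`some 0`), with `gᵢ` (`some 2`), or with
neither (`some 1`). In terms of the product `(gᵢ⁻¹ gⱼ) (gⱼ⁻¹ x)` it is the number of letters of
`gᵢ⁻¹ gⱼ` that cancel. -/
def cancelType (i j : Fin N) (x : FreeGroup ℕ) : Option (Fin 3) :=
  if i = j then none
  else if x.toWord.head? = some ((j : ℕ), true) then some 0
  else if x.toWord.head? = some ((i : ℕ), true) then some 2
  else some 1

/-- A set that contains `gᵢ⁻¹ x` if `x` is of type `s`. -/
def leftSet (s : Option (Fin 3)) (i j : Fin N) : Set (FreeGroup ℕ) :=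
  match s with
  | none => {_a | i = j}
  | some 0 => {a | a.toWord.take 2 = [((i : ℕ), false), ((j : ℕ), true)]}
  | some 1 => {a | a.toWord.head? = some ((i : ℕ), false)}
  | some 2 => Set.univ

/-- A set that contains `gⱼ⁻¹ x` if `x` is of type `s`. -/
def rightSet (s : Option (Fin 3)) (i j : Fin N) : Set (FreeGroup ℕ) :=
  match s with
  | none => Set.univ
  | some 0 => Set.univ
  | some 1 => {a | a.toWord.head? = some ((j : ℕ), false)}
  | some 2 => {a | a.toWord.take 2 = [((j : ℕ), false), ((i : ℕ), true)]}

theorem head_ne_of_ne {i j : Fin N} (hij : i ≠ j) {x : FreeGroup ℕ}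
    (h : x.toWord.head? = some ((j : ℕ), true)) : x.toWord.head? ≠ some ((i : ℕ), true) := by
  rw [h]
  intro h2
  simp only [Option.some.injEq, Prod.mk.injEq, and_true] at h2
  exact hij (Fin.ext h2.symm)

theorem take_two_of_inv_mul {i j : Fin N} (hij : i ≠ j) {x : FreeGroup ℕ}
    (h : x.toWord.head? = some ((j : ℕ), true)) :
    ((of (i : ℕ))⁻¹ * x).toWord.take 2 = [((i : ℕ), false), ((j : ℕ), true)] := by
  rw [toWord_of_inv_mul (head_ne_of_ne hij h)]
  cases hw : x.toWord with
  | nil => simp [hw] at h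
  | cons y L => simp_all

theorem mem_leftSet_cancelType (i j : Fin N) (x : FreeGroup ℕ) :
    (of (i : ℕ))⁻¹ * x ∈ leftSet (cancelType i j x) i j := by
  unfold cancelType
  split_ifs with h1 h2 h3
  · exact h1
  · exact take_two_of_inv_mul h1 h2
  · exact Set.mem_univ _
  · simp only [leftSet, Set.mem_ofPred_eq]
    rw [toWord_of_inv_mul h3]
    rfl

theorem mem_rightSet_cancelType (i j : Fin N) (x : FreeGroup ℕ) :
    (of (j : ℕ))⁻¹ * x ∈ rightSet (cancelType i j x) i j := by
  unfold cancelType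
  split_ifs with h1 h2 h3
  · exact Set.mem_univ _
  · exact Set.mem_univ _
  · exact take_two_of_inv_mul (Ne.symm h1) h3
  · simp only [rightSet, Set.mem_ofPred_eq]
    rw [toWord_of_inv_mul h2]
    rfl

/-- For `s ≠ none`, two points of the sets determine `i` and `j`; for `s = none` only `i = j` is
known. -/
theorem card_leftSet_rightSet_le (s : Option (Fin 3)) (a b : FreeGroup ℕ) :
    Nat.card {p : Fin N × Fin N // a ∈ leftSet s p.1 p.2 ∧ b ∈ rightSet s p.1 p.2} ≤
      s.elim N fun _ => 1 := by
  rcases s with _ | s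
  · have : Nat.card (Fin N) = N := by simp
    rw [Option.elim_none]
    conv_rhs => rw [← this]
    refine Nat.card_le_card_of_injective (fun p => p.1.1) ?_
    rintro ⟨⟨i, j⟩, h, _⟩ ⟨⟨i', j'⟩, h', _⟩ hii
    simp only [leftSet, Set.mem_ofPred_eq] at h h'
    simp_all
  · rw [Option.elim_some]
    refine Finite.card_le_one_iff_subsingleton.2 ⟨?_⟩
    rintro ⟨⟨i, j⟩, h, h2⟩ ⟨⟨i', j'⟩, h', h2'⟩
    suffices i = i' ∧ j = j' by
      obtain ⟨rfl, rfl⟩ := this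
      rfl
    match s with
    | 0 =>
      have := Eq.trans (Eq.symm h) h'
      simpa [Fin.ext_iff] using this
    | 1 =>
      have h3 := Eq.trans (Eq.symm h) h'
      have h4 := Eq.trans (Eq.symm h2) h2'
      simp only [Option.some.injEq, Prod.mk.injEq, and_true] at h3 h4
      exact ⟨Fin.ext h3, Fin.ext h4⟩
    | 2 =>
      have := Eq.trans (Eq.symm h2) h2'
      simpa [Fin.ext_iff, and_comm] using this

end FreeGroup

/-! ### The sum of squares of matrix coefficients over pairs of products of generators -/

section Products

/-- The element `(g_{m₁}, …, g_{m_k})` of the power of the free group. -/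
def genVector {N k : ℕ} (m : Fin k → Fin N) : Fin k → FreeGroup ℕ := fun j => FreeGroup.of (m j : ℕ)

theorem sum_sq_norm_inner_generators_le (N k : ℕ) (ξ : ℓ²(Fin k → FreeGroup ℕ, ℂ)) :
    ∑ m : Fin k → Fin N, ∑ n : Fin k → Fin N,
      ‖⟪leftTranslation (genVector m) ξ, leftTranslation (genVector n) ξ⟫_ℂ‖ ^ 2 ≤
      ((N : ℝ) + 9) ^ k * ‖ξ‖ ^ 4 := by
  classical
  let P := Fin k → Fin N × Fin N
  -- in a coordinate with different generators there are three types, each of weight three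
  let c₀ : Option (Fin 3) → ℝ := fun s => s.elim 1 fun _ => 3
  let n₀ : Option (Fin 3) → ℕ := fun s => s.elim N fun _ => 1
  let all₀ : Fin N × Fin N → Finset (Option (Fin 3)) := fun q =>
    if q.1 = q.2 then {none} else Finset.univ.map Function.Embedding.some
  have hall₀ : ∀ q, ∑ s ∈ all₀ q, (c₀ s)⁻¹ = 1 := by
    intro q
    by_cases hq : q.1 = q.2
    · simp [all₀, hq, c₀]
    · simp [all₀, hq, c₀]
  have key := sum_sq_norm_inner_leftTranslation_le
    (P := P) (S := Fin k → Option (Fin 3))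
    (fun p => genVector fun j => (p j).1) (fun p => genVector fun j => (p j).2) ξ
    (fun p => Fintype.piFinset fun j => all₀ (p j))
    (fun s => ∏ j, c₀ (s j))
    (fun s => Finset.prod_pos fun j _ => by rcases h : s j with _ | _ <;> simp [c₀])
    (fun p => by
      simp only [← Finset.prod_inv_distrib]
      rw [← Finset.prod_univ_sum (fun j => all₀ (p j)) fun _ s => (c₀ s)⁻¹]
      simp [hall₀])
    (fun p x j => cancelType (p j).1 (p j).2 (x j))
    (fun p x => by
      rw [Fintype.mem_piFinset]
      intro j
      by_cases hq : (p j).1 = (p j).2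
      · simp [all₀, cancelType, hq]
      · simp only [all₀, cancelType, hq, if_false]
        split_ifs <;> simp)
    (fun s p => {a | ∀ j, a j ∈ leftSet (s j) (p j).1 (p j).2})
    (fun s p => {a | ∀ j, a j ∈ rightSet (s j) (p j).1 (p j).2})
    (fun p x j => mem_leftSet_cancelType _ _ _)
    (fun p x j => mem_rightSet_cancelType _ _ _)
    (fun s => ∏ j, n₀ (s j))
    (fun s a b => by
      let e : {p : P // (∀ j, a j ∈ leftSet (s j) (p j).1 (p j).2) ∧
          ∀ j, b j ∈ rightSet (s j) (p j).1 (p j).2} →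
          ∀ j, {q : Fin N × Fin N // a j ∈ leftSet (s j) q.1 q.2 ∧ b j ∈ rightSet (s j) q.1 q.2} :=
        fun p j => ⟨p.1 j, p.2.1 j, p.2.2 j⟩
      have he : Function.Injective e := by
        intro p p' h
        ext1
        funext j
        exact congrArg Subtype.val (congrFun h j)
      refine (Nat.card_le_card_of_injective e he).trans ?_
      rw [Nat.card_pi]
      exact Finset.prod_le_prod' fun j _ => card_leftSet_rightSet_le _ _ _)
  have hconst : ∑ s : Fin k → Option (Fin 3), (∏ j, c₀ (s j)) * ((∏ j, n₀ (s j) : ℕ) : ℝ) =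
      ((N : ℝ) + 9) ^ k := by
    simp only [Nat.cast_prod, ← Finset.prod_mul_distrib]
    rw [← Fintype.piFinset_univ,
      ← Finset.prod_univ_sum (fun _ => Finset.univ) fun _ s => c₀ s * (n₀ s : ℝ)]
    have : ∑ s, c₀ s * (n₀ s : ℝ) = (N : ℝ) + 9 := by
      rw [Fintype.sum_option]
      simp [c₀, n₀]
      norm_num
    simp [this]
  rw [hconst] at key
  refine le_of_eq_of_le ?_ key
  rw [← Fintype.sum_prod_type']
  exact (Equiv.sum_comp (Equiv.arrowProdEquivProdArrow (Fin k) (fun _ => Fin N) fun _ => Fin N)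
    fun q => ‖⟪leftTranslation (genVector q.1) ξ, leftTranslation (genVector q.2) ξ⟫_ℂ‖ ^ 2).symm

end Products

/-! ### Product vectors -/

section ProductVectors

open InnerProductSpace (rankOne)

variable {X : Type*} {k l : ℕ}

theorem hasSum_norm_sq_mul (f : ℓ²(Fin k → X, ℂ)) (g : ℓ²(Fin l → X, ℂ)) :
    HasSum (fun x : Fin (k + l) → X =>
      ‖f (fun i => x (Fin.castAdd l i)) * g (fun i => x (Fin.natAdd k i))‖ ^ 2)
      (‖f‖ ^ 2 * ‖g‖ ^ 2) := by
  rw [← (Fin.appendEquiv k l).hasSum_iff]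
  have hf := hasSum_norm_sq f
  have hg := hasSum_norm_sq g
  have h := hf.mul hg (hf.summable.mul_of_nonneg hg.summable (fun _ => by positivity)
    fun _ => by positivity)
  convert! h using 1
  funext x
  simp [mul_pow]

/-- The vector `f ⊗ g` of `ℓ²(X^k) ⊗ ℓ²(X^l) = ℓ²(X^(k+l))`. -/
noncomputable def prodVec (f : ℓ²(Fin k → X, ℂ)) (g : ℓ²(Fin l → X, ℂ)) :
    ℓ²(Fin (k + l) → X, ℂ) :=
  ⟨fun x => f (fun i => x (Fin.castAdd l i)) * g (fun i => x (Fin.natAdd k i)),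
    memℓp_two_iff.2 (hasSum_norm_sq_mul f g).summable⟩

theorem prodVec_apply (f : ℓ²(Fin k → X, ℂ)) (g : ℓ²(Fin l → X, ℂ)) (x : Fin (k + l) → X) :
    prodVec f g x = f (fun i => x (Fin.castAdd l i)) * g (fun i => x (Fin.natAdd k i)) := rfl

theorem norm_prodVec (f : ℓ²(Fin k → X, ℂ)) (g : ℓ²(Fin l → X, ℂ)) :
    ‖prodVec f g‖ = ‖f‖ * ‖g‖ := by
  have h := (hasSum_norm_sq (prodVec f g)).unique (hasSum_norm_sq_mul f g)
  rw [← mul_pow] at h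
  exact (pow_left_inj₀ (by positivity) (by positivity) two_ne_zero).1 h

theorem inner_prodVec (f f' : ℓ²(Fin k → X, ℂ)) (g g' : ℓ²(Fin l → X, ℂ)) :
    ⟪prodVec f g, prodVec f' g'⟫_ℂ = ⟪f, f'⟫_ℂ * ⟪g, g'⟫_ℂ := by
  have hn : ∀ {Y : Type _} (f f' : ℓ²(Y, ℂ)), Summable fun y => ‖⟪f y, f' y⟫_ℂ‖ := by
    intro Y f f'
    refine Summable.of_nonneg_of_le (fun y => by positivity) (fun y => ?_)
      ((hasSum_norm_sq f).summable.add (hasSum_norm_sq f').summable)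
    refine (norm_inner_le_norm _ _).trans ?_
    nlinarith [sq_nonneg (‖f y‖ - ‖f' y‖), sq_nonneg ‖f y‖, sq_nonneg ‖f' y‖]
  rw [lp.inner_eq_tsum, lp.inner_eq_tsum, lp.inner_eq_tsum,
    tsum_mul_tsum_of_summable_norm (hn f f') (hn g g'), ← (Fin.appendEquiv k l).tsum_eq]
  refine tsum_congr fun x => ?_
  simp only [prodVec_apply, Fin.appendEquiv_apply, Fin.append_left, Fin.append_right,
    RCLike.inner_apply, map_mul]
  ring

/-- The map `f ↦ f ⊗ g`. -/
noncomputable def prodVecLeft (k : ℕ) (g : ℓ²(Fin l → X, ℂ)) :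
    ℓ²(Fin k → X, ℂ) →L[ℂ] ℓ²(Fin (k + l) → X, ℂ) :=
  LinearMap.mkContinuous
    { toFun := fun f => prodVec f g
      map_add' := fun f f' => by
        ext x
        exact add_mul _ _ _
      map_smul' := fun c f => by
        ext x
        exact mul_assoc _ _ _ }
    ‖g‖ (fun f => by
      rw [mul_comm]
      exact (norm_prodVec f g).le)

/-- The map `g ↦ f ⊗ g`. -/
noncomputable def prodVecRight (l : ℕ) (f : ℓ²(Fin k → X, ℂ)) :
    ℓ²(Fin l → X, ℂ) →L[ℂ] ℓ²(Fin (k + l) → X, ℂ) :=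
  LinearMap.mkContinuous
    { toFun := fun g => prodVec f g
      map_add' := fun g g' => by
        ext x
        exact mul_add _ _ _
      map_smul' := fun c g => by
        ext x
        exact mul_left_comm _ _ _ }
    ‖f‖ (fun g => (norm_prodVec f g).le)

theorem comp_sum_smul_rankOne_comp_adjoint {H K : Type*} [NormedAddCommGroup H]
    [InnerProductSpace ℂ H] [CompleteSpace H] [NormedAddCommGroup K] [InnerProductSpace ℂ K]
    [CompleteSpace K] {ι : Type*} [Fintype ι] (L : K →L[ℂ] H) (c : ι → ℂ) (a : ι → K) :
    L ∘L (∑ i, c i • rankOne ℂ (a i) (a i)) ∘L ContinuousLinearMap.adjoint L =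
      ∑ i, c i • rankOne ℂ (L (a i)) (L (a i)) := by
  simp only [ContinuousLinearMap.finsetSum_comp, ContinuousLinearMap.comp_finsetSum,
    ContinuousLinearMap.smul_comp, ContinuousLinearMap.comp_smul, comp_rankOne_comp_adjoint]

/-- If `∑ₘ |vₘ⟩⟨vₘ|` and `∑ₙ |wₙ⟩⟨wₙ|` are diagonal in the families `b` and `c`, then
`∑ₘₙ |vₘ ⊗ wₙ⟩⟨vₘ ⊗ wₙ|` is diagonal in the family of the `bᵢ ⊗ cⱼ`. -/
theorem sum_rankOne_prodVec {κ κ' ι ι' : Type*} [Fintype κ] [Fintype κ'] [Fintype ι] [Fintype ι']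
    {v : κ → ℓ²(Fin k → X, ℂ)} {w : κ' → ℓ²(Fin l → X, ℂ)} {b : ι → ℓ²(Fin k → X, ℂ)}
    {c : ι' → ℓ²(Fin l → X, ℂ)} {r : ι → ℝ} {s : ι' → ℝ}
    (hv : ∑ m, rankOne ℂ (v m) (v m) = ∑ i, (r i : ℂ) • rankOne ℂ (b i) (b i))
    (hw : ∑ n, rankOne ℂ (w n) (w n) = ∑ j, (s j : ℂ) • rankOne ℂ (c j) (c j)) :
    ∑ m, ∑ n, rankOne ℂ (prodVec (v m) (w n)) (prodVec (v m) (w n)) =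
      ∑ q : ι × ι', ((r q.1 * s q.2 : ℝ) : ℂ) •
        rankOne ℂ (prodVec (b q.1) (c q.2)) (prodVec (b q.1) (c q.2)) := by
  have h1 : ∀ n, ∑ m, rankOne ℂ (prodVec (v m) (w n)) (prodVec (v m) (w n)) =
      ∑ i, (r i : ℂ) • rankOne ℂ (prodVec (b i) (w n)) (prodVec (b i) (w n)) := by
    intro n
    have h := congrArg (fun S => prodVecLeft k (w n) ∘L S ∘L
      ContinuousLinearMap.adjoint (prodVecLeft k (w n))) hv
    simp only [comp_sum_smul_rankOne_comp_adjoint] at h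
    have h2 := comp_sum_smul_rankOne_comp_adjoint (prodVecLeft k (w n)) (fun _ => 1) v
    simp only [one_smul] at h2
    rw [h2] at h
    exact h
  have h3 : ∀ i, ∑ n, rankOne ℂ (prodVec (b i) (w n)) (prodVec (b i) (w n)) =
      ∑ j, (s j : ℂ) • rankOne ℂ (prodVec (b i) (c j)) (prodVec (b i) (c j)) := by
    intro i
    have h := congrArg (fun S => prodVecRight l (b i) ∘L S ∘L
      ContinuousLinearMap.adjoint (prodVecRight l (b i))) hw
    simp only [comp_sum_smul_rankOne_comp_adjoint] at h
    have h2 := comp_sum_smul_rankOne_comp_adjoint (prodVecRight l (b i)) (fun _ => 1) w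
    simp only [one_smul] at h2
    rw [h2] at h
    exact h
  rw [Finset.sum_comm]
  simp only [h1]
  rw [Finset.sum_comm]
  simp only [← Finset.smul_sum, h3]
  rw [Fintype.sum_prod_type]
  refine Finset.sum_congr rfl fun i _ => ?_
  rw [Finset.smul_sum]
  refine Finset.sum_congr rfl fun j _ => ?_
  rw [smul_smul, Complex.ofReal_mul]

theorem orthonormal_prodVec {ι ι' : Type*} {b : ι → ℓ²(Fin k → X, ℂ)}
    {c : ι' → ℓ²(Fin l → X, ℂ)} (hb : Orthonormal ℂ b) (hc : Orthonormal ℂ c) :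
    Orthonormal ℂ fun q : ι × ι' => prodVec (b q.1) (c q.2) := by
  classical
  rw [orthonormal_iff_ite] at hb hc ⊢
  rintro ⟨i, j⟩ ⟨i', j'⟩
  rw [inner_prodVec, hb, hc]
  by_cases hi : i = i' <;> by_cases hj : j = j' <;> simp [hi, hj]

/-- Entropy is additive on products of finite rank states. -/
theorem entropy_prodVec {κ κ' : Type*} [Fintype κ] [Fintype κ']
    {v : κ → ℓ²(Fin k → X, ℂ)} {w : κ' → ℓ²(Fin l → X, ℂ)}
    (hv1 : ∑ m, ‖v m‖ ^ 2 = 1) (hw1 : ∑ n, ‖w n‖ ^ 2 = 1)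
    {ρ : TraceClass ℓ²(Fin k → X, ℂ)} {σ : TraceClass ℓ²(Fin l → X, ℂ)}
    {ω : TraceClass ℓ²(Fin (k + l) → X, ℂ)}
    (hρ : (ρ : ℓ²(Fin k → X, ℂ) →L[ℂ] ℓ²(Fin k → X, ℂ)) = ∑ m, rankOne ℂ (v m) (v m))
    (hσ : (σ : ℓ²(Fin l → X, ℂ) →L[ℂ] ℓ²(Fin l → X, ℂ)) = ∑ n, rankOne ℂ (w n) (w n))
    (hω : (ω : ℓ²(Fin (k + l) → X, ℂ) →L[ℂ] ℓ²(Fin (k + l) → X, ℂ)) =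
      ∑ m, ∑ n, rankOne ℂ (prodVec (v m) (w n)) (prodVec (v m) (w n))) :
    entropy ω = entropy ρ + entropy σ := by
  obtain ⟨_, b, r, hb, hr, hbv, hr1, -⟩ := exists_spectral_decomposition v
  obtain ⟨_, c, s, hc, hs, hcw, hs1, -⟩ := exists_spectral_decomposition w
  rw [hv1] at hr1
  rw [hw1] at hs1
  have hr' : ∀ i, r i ≤ 1 := fun i =>
    hr1 ▸ Finset.single_le_sum (fun i _ => hr i) (Finset.mem_univ i)
  have hs' : ∀ j, s j ≤ 1 := fun j =>
    hs1 ▸ Finset.single_le_sum (fun j _ => hs j) (Finset.mem_univ j)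
  rw [entropy_eq_sum hb r (hρ.trans hbv), entropy_eq_sum hc s (hσ.trans hcw),
    entropy_eq_sum (orthonormal_prodVec hb hc) (fun q => r q.1 * s q.2)
      (hω.trans (sum_rankOne_prodVec hbv hcw))]
  have hrn : ∀ i, 0 ≤ Real.negMulLog (r i) := fun i => Real.negMulLog_nonneg (hr i) (hr' i)
  have hsn : ∀ j, 0 ≤ Real.negMulLog (s j) := fun j => Real.negMulLog_nonneg (hs j) (hs' j)
  rw [← ENNReal.ofReal_sum_of_nonneg fun i _ => hrn i,
    ← ENNReal.ofReal_sum_of_nonneg fun j _ => hsn j, ← ENNReal.ofReal_add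
      (Finset.sum_nonneg fun i _ => hrn i) (Finset.sum_nonneg fun j _ => hsn j),
    ← ENNReal.ofReal_sum_of_nonneg fun q _ => Real.negMulLog_nonneg
      (mul_nonneg (hr _) (hs _)) (mul_le_one₀ (hr' _) (hs _) (hs' _))]
  congr 1
  simp only [Real.negMulLog_mul]
  rw [Finset.sum_add_distrib, Fintype.sum_prod_type, Fintype.sum_prod_type]
  simp only [← Finset.sum_mul, ← Finset.mul_sum, hs1, hr1, one_mul]

end ProductVectors

/-! ### The outputs of the tensor powers of the channel -/

section Outputs

open InnerProductSpace (rankOne)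

theorem leftTranslation_apply {G : Type*} [Group G] (g : G) (f : ℓ²(G, ℂ)) (x : G) :
    leftTranslation g f x = f (g⁻¹ * x) := rfl

theorem norm_leftTranslation {G : Type*} [Group G] (g : G) (f : ℓ²(G, ℂ)) :
    ‖leftTranslation g f‖ = ‖f‖ := by
  have h : HasSum (fun x => ‖leftTranslation g f x‖ ^ 2) (‖f‖ ^ 2) :=
    (Equiv.mulLeft g⁻¹).hasSum_iff.2 (hasSum_norm_sq f)
  exact (pow_left_inj₀ (by positivity) (by positivity) two_ne_zero).1
    ((hasSum_norm_sq (leftTranslation g f)).unique h)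

theorem tensorOp_smul_leftTranslation {G : Type*} [Group G] {k : ℕ} (c : ℂ) (g : Fin k → G) :
    tensorOp (fun j => c • leftTranslation (g j)) = c ^ k • leftTranslation g := by
  -- the factors with index in `L` act on the coordinates in `L`, and on no others
  have key : ∀ L : List (Fin k), L.Nodup → ∀ (f : ℓ²(Fin k → G, ℂ)) x,
      (L.map fun j => actOnFactor j (c • leftTranslation (g j))).prod f x =
        c ^ L.length * f (fun j => if j ∈ L then (g j)⁻¹ * x j else x j) := by
    intro L
    induction L with
    | nil => intro _ f x; simp
    | cons i L ih =>
      intro hL f x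
      rw [List.nodup_cons] at hL
      rw [List.map_cons, List.prod_cons, mul_apply_eq_comp, actOnFactor_apply, smul_apply,
        lp.coeFn_smul, Pi.smul_apply, leftTranslation_apply, slice_apply, ih hL.2, smul_eq_mul,
        ← mul_assoc, List.length_cons, pow_succ']
      refine congrArg (_ * f ·) (funext fun j => ?_)
      by_cases hj : j = i
      · subst hj
        simp [hL.1]
      · simp [hj]
  ext f x
  rw [tensorOp, List.ofFn_eq_map, key _ (List.nodup_finRange k)]
  simp only [List.length_finRange, List.mem_finRange, if_true]
  rfl

variable {N k l : ℕ}

/-- The vector `(E_{m₁} ⊗ ⋯ ⊗ E_{m_k}) ξ`, where the `Eᵢ` are the Kraus operators of the channel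
of the free group. -/
noncomputable def outputVec (m : Fin k → Fin N) (ξ : ℓ²(Fin k → FreeGroup ℕ, ℂ)) :
    ℓ²(Fin k → FreeGroup ℕ, ℂ) :=
  ((Real.sqrt N : ℂ)⁻¹) ^ k • leftTranslation (genVector m) ξ

theorem tensorPower_freeKraus_pureState (ξ : ℓ²(Fin k → FreeGroup ℕ, ℂ)) :
    (tensorPower (freeKraus N) k (pureState ξ) :
      ℓ²(Fin k → FreeGroup ℕ, ℂ) →L[ℂ] ℓ²(Fin k → FreeGroup ℕ, ℂ)) =
      ∑ m : Fin k → Fin N, rankOne ℂ (outputVec m ξ) (outputVec m ξ) := by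
  change ∑ m : Fin k → Fin N, _ ∘L rankOne ℂ ξ ξ ∘L _ = _
  refine Finset.sum_congr rfl fun m _ => ?_
  rw [comp_rankOne_comp_adjoint]
  simp only [freeKraus, tensorOp_smul_leftTranslation]
  rfl

theorem norm_sqrt_inv_pow_sq (N k : ℕ) : ‖((Real.sqrt N : ℂ)⁻¹) ^ k‖ ^ 2 = ((N : ℝ) ^ k)⁻¹ := by
  rw [norm_pow, norm_inv, Complex.norm_real, Real.norm_of_nonneg (Real.sqrt_nonneg _),
    ← pow_mul, mul_comm, pow_mul, inv_pow, Real.sq_sqrt (Nat.cast_nonneg N), inv_pow]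

theorem sum_norm_sq_outputVec (hN : 1 ≤ N) {ξ : ℓ²(Fin k → FreeGroup ℕ, ℂ)} (hξ : ‖ξ‖ = 1) :
    ∑ m : Fin k → Fin N, ‖outputVec m ξ‖ ^ 2 = 1 := by
  have hN' : (N : ℝ) ≠ 0 := by positivity
  simp only [outputVec, norm_smul, norm_leftTranslation, hξ, mul_one, norm_sqrt_inv_pow_sq]
  simp [hN']

theorem sum_sq_norm_inner_outputVec_le {ξ : ℓ²(Fin k → FreeGroup ℕ, ℂ)}
    (hN : 1 ≤ N) (hξ : ‖ξ‖ = 1) :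
    ∑ m : Fin k → Fin N, ∑ n : Fin k → Fin N, ‖⟪outputVec m ξ, outputVec n ξ⟫_ℂ‖ ^ 2 ≤
      (1 + 9 / N : ℝ) ^ k / (N : ℝ) ^ k := by
  have hN' : (0 : ℝ) < N := by positivity
  have h := sum_sq_norm_inner_generators_le N k ξ
  rw [hξ, one_pow, mul_one] at h
  have he : ∀ m n : Fin k → Fin N, ‖⟪outputVec m ξ, outputVec n ξ⟫_ℂ‖ ^ 2 =
      (((N : ℝ) ^ k)⁻¹ * ((N : ℝ) ^ k)⁻¹) *
        ‖⟪leftTranslation (genVector m) ξ, leftTranslation (genVector n) ξ⟫_ℂ‖ ^ 2 := by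
    intro m n
    rw [outputVec, outputVec, inner_smul_left, inner_smul_right, norm_mul, norm_mul,
      RCLike.norm_conj, mul_pow, mul_pow, norm_sqrt_inv_pow_sq, mul_assoc]
  simp only [he, ← Finset.mul_sum]
  calc _ ≤ (((N : ℝ) ^ k)⁻¹ * ((N : ℝ) ^ k)⁻¹) * ((N : ℝ) + 9) ^ k := by gcongr
    _ = _ := by
      rw [show (1 + 9 / N : ℝ) = (N + 9) / N by field_simp, div_pow]
      field_simp

/-- The lower bound for the output entropy that comes from the Rényi entropy of order two. -/
theorem le_entropy_tensorPower (hN : 1 ≤ N) {ξ : ℓ²(Fin k → FreeGroup ℕ, ℂ)} (hξ : ‖ξ‖ = 1) :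
    ENNReal.ofReal (k * (Real.log N - Real.log (1 + 9 / N))) ≤
      entropy (tensorPower (freeKraus N) k (pureState ξ)) := by
  have hN' : (0 : ℝ) < N := by positivity
  obtain ⟨_, b, r, hb, hr, hbv, hr1, hr2⟩ :=
    exists_spectral_decomposition fun m : Fin k → Fin N => outputVec m ξ
  rw [sum_norm_sq_outputVec hN hξ] at hr1
  have hr' : ∀ i, r i ≤ 1 := fun i =>
    hr1 ▸ Finset.single_le_sum (fun i _ => hr i) (Finset.mem_univ i)
  rw [entropy_eq_sum hb r ((tensorPower_freeKraus_pureState ξ).trans hbv),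
    ← ENNReal.ofReal_sum_of_nonneg fun i _ => Real.negMulLog_nonneg (hr i) (hr' i)]
  refine ENNReal.ofReal_le_ofReal (le_trans ?_ (neg_log_sum_sq_le_sum_negMulLog hr hr1))
  have hpos : 0 < ∑ i, r i ^ 2 := by
    obtain ⟨i, hi⟩ : ∃ i, r i ≠ 0 := by
      by_contra! h
      simp [h] at hr1
    exact Finset.sum_pos' (fun i _ => sq_nonneg _) ⟨i, Finset.mem_univ i, by positivity⟩
  have h := Real.log_le_log hpos (hr2.trans_le (sum_sq_norm_inner_outputVec_le hN hξ))
  rw [Real.log_div (by positivity) (by positivity), Real.log_pow, Real.log_pow] at h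
  linarith

theorem entropy_tensorPower_ne_top (ξ : ℓ²(Fin k → FreeGroup ℕ, ℂ)) :
    entropy (tensorPower (freeKraus N) k (pureState ξ)) ≠ ∞ := by
  obtain ⟨_, b, r, hb, -, hbv, -, -⟩ :=
    exists_spectral_decomposition fun m : Fin k → Fin N => outputVec m ξ
  rw [entropy_eq_sum hb r ((tensorPower_freeKraus_pureState ξ).trans hbv)]
  exact ENNReal.sum_ne_top.2 fun _ _ => ENNReal.ofReal_ne_top

theorem outputVec_append (m : Fin k → Fin N) (n : Fin l → Fin N)
    (ξ : ℓ²(Fin k → FreeGroup ℕ, ℂ)) (η : ℓ²(Fin l → FreeGroup ℕ, ℂ)) :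
    outputVec (Fin.append m n) (prodVec ξ η) = prodVec (outputVec m ξ) (outputVec n η) := by
  ext x
  simp only [outputVec, prodVec_apply, lp.coeFn_smul, Pi.smul_apply, leftTranslation_apply,
    genVector, Pi.mul_apply, Pi.inv_apply, Fin.append_left, Fin.append_right, smul_eq_mul, pow_add]
  change _ * (ξ (fun i => (FreeGroup.of ((m i : ℕ)))⁻¹ * x (Fin.castAdd l i)) *
    η (fun i => (FreeGroup.of ((n i : ℕ)))⁻¹ * x (Fin.natAdd k i))) =
    (_ * ξ (fun i => (FreeGroup.of ((m i : ℕ)))⁻¹ * x (Fin.castAdd l i))) *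
    (_ * η (fun i => (FreeGroup.of ((n i : ℕ)))⁻¹ * x (Fin.natAdd k i)))
  ring

theorem entropy_tensorPower_prodVec (hN : 1 ≤ N) {ξ : ℓ²(Fin k → FreeGroup ℕ, ℂ)}
    {η : ℓ²(Fin l → FreeGroup ℕ, ℂ)} (hξ : ‖ξ‖ = 1) (hη : ‖η‖ = 1) :
    entropy (tensorPower (freeKraus N) (k + l) (pureState (prodVec ξ η))) =
      entropy (tensorPower (freeKraus N) k (pureState ξ)) +
        entropy (tensorPower (freeKraus N) l (pureState η)) := by
  refine entropy_prodVec (sum_norm_sq_outputVec hN hξ) (sum_norm_sq_outputVec hN hη)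
    (tensorPower_freeKraus_pureState ξ) (tensorPower_freeKraus_pureState η) ?_
  rw [tensorPower_freeKraus_pureState, ← (Fin.appendEquiv k l).sum_comp, Fintype.sum_prod_type]
  refine Finset.sum_congr rfl fun m _ => Finset.sum_congr rfl fun n _ => ?_
  rw [← outputVec_append]
  rfl

end Outputs

/-! ### The minimum output entropy and its regularization -/

section Regularization

variable {N : ℕ}

theorem minOutputEntropy_add_le (hN : 1 ≤ N) (k l : ℕ) :
    minOutputEntropy (tensorPower (freeKraus N) (k + l)) ≤
      minOutputEntropy (tensorPower (freeKraus N) k) +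
        minOutputEntropy (tensorPower (freeKraus N) l) := by
  simp only [minOutputEntropy, ENNReal.iInf_add, ENNReal.add_iInf]
  refine le_iInf fun η => le_iInf fun ξ => ?_
  rw [← entropy_tensorPower_prodVec hN ξ.2 η.2]
  exact iInf_le (fun ζ : {ζ : ℓ²(Fin (k + l) → FreeGroup ℕ, ℂ) // ‖ζ‖ = 1} =>
    entropy (tensorPower (freeKraus N) (k + l) (pureState (ζ : ℓ²(Fin (k + l) → FreeGroup ℕ, ℂ)))))
    ⟨prodVec ξ η, by rw [norm_prodVec, ξ.2, η.2, one_mul]⟩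

theorem minOutputEntropy_ne_top (k : ℕ) :
    minOutputEntropy (tensorPower (freeKraus N) k) ≠ ∞ := by
  classical
  let ξ : ℓ²(Fin k → FreeGroup ℕ, ℂ) := lp.single 2 1 1
  have hξ : ‖ξ‖ = 1 := by simp [ξ, lp.norm_single]
  exact ne_top_of_le_ne_top (entropy_tensorPower_ne_top ξ)
    (iInf_le (fun ζ : {ζ : ℓ²(Fin k → FreeGroup ℕ, ℂ) // ‖ζ‖ = 1} =>
      entropy (tensorPower (freeKraus N) k (pureState (ζ : ℓ²(Fin k → FreeGroup ℕ, ℂ))))) ⟨ξ, hξ⟩)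

theorem le_minOutputEntropy (hN : 1 ≤ N) (k : ℕ) :
    ENNReal.ofReal (k * (Real.log N - Real.log (1 + 9 / N))) ≤
      minOutputEntropy (tensorPower (freeKraus N) k) :=
  le_iInf fun ξ => le_entropy_tensorPower hN ξ.2

/-- Fekete's lemma for the minimum output entropies of the tensor powers. -/
theorem exists_tendsto_minOutputEntropy_div (hN : 1 ≤ N) :
    ∃ L : ℝ, Real.log N - Real.log (1 + 9 / N) ≤ L ∧
      Filter.Tendsto (fun k : ℕ => minOutputEntropy (tensorPower (freeKraus N) k) / (k : ℝ≥0∞))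
        Filter.atTop (𝓝 (ENNReal.ofReal L)) := by
  set u : ℕ → ℝ := fun k => (minOutputEntropy (tensorPower (freeKraus N) k)).toReal with hu
  have hsub : Subadditive u := fun k l => by
    rw [hu, ← ENNReal.toReal_add (minOutputEntropy_ne_top k) (minOutputEntropy_ne_top l)]
    exact ENNReal.toReal_mono
      (ENNReal.add_ne_top.2 ⟨minOutputEntropy_ne_top k, minOutputEntropy_ne_top l⟩)
      (minOutputEntropy_add_le hN k l)
  have hlim := hsub.tendsto_lim ⟨0, by
    rintro _ ⟨k, rfl⟩
    exact div_nonneg ENNReal.toReal_nonneg (Nat.cast_nonneg k)⟩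
  refine ⟨hsub.lim, ?_, ?_⟩
  · refine ge_of_tendsto hlim ?_
    filter_upwards [Filter.eventually_ge_atTop 1] with k hk
    rw [le_div_iff₀ (by positivity), mul_comm]
    exact (ENNReal.ofReal_le_iff_le_toReal (minOutputEntropy_ne_top k)).1
      (le_minOutputEntropy hN k)
  · refine (ENNReal.tendsto_ofReal hlim).congr' ?_
    filter_upwards [Filter.eventually_ge_atTop 1] with k hk
    rw [ENNReal.ofReal_div_of_pos (by positivity), hu,
      ENNReal.ofReal_toReal (minOutputEntropy_ne_top k), ENNReal.ofReal_natCast]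

theorem coe_le_of_ofReal_le {r : ℝ} {a : ℝ≥0∞} (h : ENNReal.ofReal r ≤ a) :
    (r : EReal) ≤ (a : EReal) := by
  refine le_trans ?_ (EReal.coe_ennreal_le_coe_ennreal_iff.2 h)
  rw [EReal.coe_ennreal_ofReal]
  exact_mod_cast le_max_left r 0

/-- Since `(1 + √(x - 1))² ≥ x` for `x ≥ 1`. -/
theorem log_le_two_mul_log_one_add_sqrt {x : ℝ} (hx : 1 ≤ x) :
    Real.log x ≤ 2 * Real.log (1 + √(x - 1)) := by
  have h := Real.sq_sqrt (sub_nonneg.2 hx)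
  have h0 := Real.sqrt_nonneg (x - 1)
  rw [← Nat.cast_two, ← Real.log_pow]
  exact Real.log_le_log (by positivity) (by nlinarith)

end Regularization

end RegMOE

theorem mainTheorem3 (N : ℕ) (hN : 1 ≤ N) :
    (∀ k : ℕ,
      ((k * Real.log N - 2 * Real.log (1 + Real.sqrt ((1 + 9 / N) ^ k - 1)) : ℝ) : EReal) ≤
        (RegMOE.minOutputEntropy (RegMOE.tensorPower (RegMOE.freeKraus N) k) : EReal)) ∧
    Filter.Tendsto
      (fun k : ℕ =>
        RegMOE.minOutputEntropy (RegMOE.tensorPower (RegMOE.freeKraus N) k) / (k : ℝ≥0∞))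
      Filter.atTop (𝓝 (RegMOE.regularizedMOE (RegMOE.freeKraus N))) ∧
    RegMOE.regularizedMOE (RegMOE.freeKraus N) ≠ ∞ ∧
    ((Real.log N - Real.log (1 + 9 / N) : ℝ) : EReal) ≤
      (RegMOE.regularizedMOE (RegMOE.freeKraus N) : EReal) ∧
    Real.log N - 9 / N ≤ Real.log N - Real.log (1 + 9 / N) := by
  obtain ⟨L, hL, hlim⟩ := RegMOE.exists_tendsto_minOutputEntropy_div hN
  have hreg : RegMOE.regularizedMOE (RegMOE.freeKraus N) = ENNReal.ofReal L := hlim.limUnder_eq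
  rw [hreg]
  refine ⟨fun k => ?_, hlim, ENNReal.ofReal_ne_top, ?_, ?_⟩
  · refine le_trans ?_ (RegMOE.coe_le_of_ofReal_le (RegMOE.le_minOutputEntropy hN k))
    have h := RegMOE.log_le_two_mul_log_one_add_sqrt
      (x := (1 + 9 / N : ℝ) ^ k) (one_le_pow₀ (by linarith [show (0 : ℝ) ≤ 9 / N by positivity]))
    rw [Real.log_pow] at h
    rw [EReal.coe_le_coe_iff]
    linarith
  · exact RegMOE.coe_le_of_ofReal_le (ENNReal.ofReal_le_ofReal hL)
  · have := Real.log_le_sub_one_of_pos (x := 1 + 9 / N) (by positivity)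
    linarith
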